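/- Let $p$ be a prime number and let $\Delta\subset\mathbb{R}^d$ be a $d$-dimensional lattice simplex, with vertices $v_0,\dots,v_d\in\mathbb{Z}^d$, of normalized volume ($d!$ times the Euclidean volume) $p^2$. For an ordering $v_0,\dots,v_d$ of the vertices put $$\Lambda_\Delta=\Big\{(\lambda_0,\dots,\lambda_d)\in(\mathbb{R}/\mathbb{Z})^{d+1} : \sum_{i=0}^{d}\lambda_i(v_i,1)\in\mathbb{Z}^{d+1}\Big\},$$ a finite abelian group. Suppose that $\Delta$ is not a lattice pyramid over a lower-dimensional lattice simplex, i.e. $\Delta$ is not the image, under a map $x\mapsto xU+w$ with $U\in\mathbb{Z}^{d\times d}$, $\det U=\pm1$, $w\in\mathbb{Z}^d$, of $\mathrm{conv}(Q\times\{0\},(0,\dots,0,1))$ for a $(d-1)$-dimensional lattice simplex $Q\subset\mathbb{R}^{d-1}$. A lattice polytope $P\subset\mathbb{R}^d$ is reflexive if the origin is the unique lattice point in its interior and $P^\vee=\{y\in\mathbb{R}^d:\langle x,y\rangle\le 1\ \text{for all}\ x\in P\}$ is also a lattice polytope; a lattice polytope $P$ is Gorenstein of index $r$, where $r$ is a positive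 integer, if $rP+w$ is reflexive for some $w\in\mathbb{Z}^d$. Then $\Delta$ is Gorenstein of index $r$ if and only if one of the following holds: (1) There is an integer $s$ with $0\le s\le d-1$ such that $rp^2-1=(d-s)+ps$ and, for some ordering of the vertices of $\Delta$, $\Lambda_\Delta$ is generated by $$\Big(\underbrace{\tfrac1p,\dots,\tfrac1p}_{s},\underbrace{\tfrac1{p^2},\dots,\tfrac1{p^2}}_{d-s+1}\Big).$$ (2) $d=rp-1$, and there are an integer $s$ with $1\le s\le d-1$ and integers $1\le a_1,\dots,a_{s-1}\le p-1$ such that, for some ordering of the vertices of $\Delta$, $\Lambda_\Delta$ is generated by the two elements $$\Big(\tfrac{2-\sum_{1\le i\le s-1}a_i}{p},\tfrac{a_1+1}{p},\dots,\tfrac{a_{s-1}+1}{p},0,\underbrace{\tfrac1p,\dots,\tfrac1p}_{d-s}\Big)$$ and $$\Big(\tfrac{(\sum_{1\le i\le s-1}a_i)-1}{p},\tfrac{p-a_1}{p},\dots,\tfrac{p-a_{s-1}}{p},\tfrac1p,\underbrace{0,\dots,0}_{d-s}\Big).$$ -/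

import Mathlib

open MeasureTheory
open scoped Matrix

namespace GorensteinSimplex

/-- An integer vector regarded as a lattice point of `ℝ^d`. -/
def toReal {d : ℕ} (z : Fin d → ℤ) : Fin d → ℝ := fun j => (z j : ℝ)

/-- The convex hull of the lattice points `v 0, …, v n` in `ℝ^d`. -/
def hull {d n : ℕ} (v : Fin (n + 1) → Fin d → ℤ) : Set (Fin d → ℝ) :=
  convexHull ℝ (Set.range fun i => toReal (v i))

/-- `v 0, …, v d` are the vertices of a `d`-dimensional simplex in `ℝ^d`. -/
def AreSimplexVertices {d : ℕ} (v : Fin (d + 1) → Fin d → ℤ) : Prop :=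
  AffineIndependent ℝ fun i => toReal (v i)

/-- `P ⊆ ℝ^d` is a `d`-dimensional lattice simplex. -/
def IsLatticeSimplex {d : ℕ} (P : Set (Fin d → ℝ)) : Prop :=
  ∃ v : Fin (d + 1) → Fin d → ℤ, AreSimplexVertices v ∧ P = hull v

/-- `P ⊆ ℝ^d` is a (nonempty) lattice polytope. -/
def IsLatticePolytope {d : ℕ} (P : Set (Fin d → ℝ)) : Prop :=
  ∃ S : Finset (Fin d → ℤ), S.Nonempty ∧ P = convexHull ℝ (toReal '' (S : Set (Fin d → ℤ)))

/-- The normalized volume: `d!` times the Lebesgue measure. -/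
noncomputable def normalizedVolume {d : ℕ} (P : Set (Fin d → ℝ)) : ℝ :=
  (d.factorial : ℝ) * (volume : Measure (Fin d → ℝ)).real P

/-- The group `Λ` of the simplex with ordered vertices `v 0, …, v d`: all
`(l 0, …, l d) ∈ (ℝ/ℤ)^(d+1)` with `∑ i, l i (v i, 1) ∈ ℤ^(d+1)`. As the `v i` are integral,
each coordinate of this sum is an element of `ℝ/ℤ`, and it is integral iff that element is `0`. -/
noncomputable def vertexGroup {d : ℕ} (v : Fin (d + 1) → Fin d → ℤ) :
    AddSubgroup (Fin (d + 1) → UnitAddCircle) where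
  carrier := {l | (∀ j : Fin d, ∑ i, v i j • l i = 0) ∧ ∑ i, l i = 0}
  zero_mem' := by simp
  add_mem' := by
    rintro a b ⟨ha, ha'⟩ ⟨hb, hb'⟩
    refine ⟨fun j => ?_, ?_⟩
    · simp [Finset.sum_add_distrib, ha j, hb j]
    · simp [Finset.sum_add_distrib, ha', hb']
  neg_mem' := by
    rintro a ⟨ha, ha'⟩
    refine ⟨fun j => ?_, ?_⟩
    · simp [ha j]
    · simp [ha']

/-- The class in `(ℝ/ℤ)^(d+1)` of a real vector. -/
noncomputable def torusClass {d : ℕ} (x : Fin (d + 1) → ℝ) : Fin (d + 1) → UnitAddCircle :=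
  fun i => (x i : UnitAddCircle)

/-- Unimodular equivalence of subsets of `ℝ^d`: `Q = P U + w` with `U` an integral matrix of
determinant `±1` and `w` an integral vector. -/
def UnimodularlyEquivalent {d : ℕ} (P Q : Set (Fin d → ℝ)) : Prop :=
  ∃ (U : Matrix (Fin d) (Fin d) ℤ) (w : Fin d → ℤ), (U.det = 1 ∨ U.det = -1) ∧
    Q = (fun x : Fin d → ℝ => x ᵥ* U.map (fun z : ℤ => (z : ℝ)) + toReal w) '' P

/-- The pyramid `conv (Q × {0}, (0, …, 0, 1)) ⊆ ℝ^(d+1)` over `Q ⊆ ℝ^d`. -/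
def pyramid {d : ℕ} (Q : Set (Fin d → ℝ)) : Set (Fin (d + 1) → ℝ) :=
  convexHull ℝ
    ((fun x : Fin d → ℝ => (Fin.snoc x (0 : ℝ) : Fin (d + 1) → ℝ)) '' Q ∪
      {Pi.single (Fin.last d) (1 : ℝ)})

/-- `P ⊆ ℝ^d` is, up to unimodular equivalence, the lattice pyramid over a lattice simplex of
dimension `d - 1` (this never holds for `d = 0`). -/
def IsLatticePyramid : {d : ℕ} → Set (Fin d → ℝ) → Prop
  | 0, _ => False
  | _ + 1, P => ∃ Q, IsLatticeSimplex Q ∧ UnimodularlyEquivalent (pyramid Q) P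

/-- The dual `{y | ⟨x, y⟩ ≤ 1 for all x ∈ P}`. -/
def dual {d : ℕ} (P : Set (Fin d → ℝ)) : Set (Fin d → ℝ) :=
  {y | ∀ x ∈ P, x ⬝ᵥ y ≤ 1}

/-- A lattice polytope is reflexive if the origin is the unique lattice point in its interior
and its dual is a lattice polytope. -/
def IsReflexive {d : ℕ} (P : Set (Fin d → ℝ)) : Prop :=
  IsLatticePolytope P ∧ (∀ z : Fin d → ℤ, toReal z ∈ interior P ↔ z = 0) ∧
    IsLatticePolytope (dual P)

/-- A lattice polytope `P` is Gorenstein of index `r > 0` if `r P + w` is reflexive for some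
lattice point `w`. -/
def IsGorensteinOfIndex {d : ℕ} (r : ℕ) (P : Set (Fin d → ℝ)) : Prop :=
  0 < r ∧ IsLatticePolytope P ∧
    ∃ w : Fin d → ℤ, IsReflexive ((fun x : Fin d → ℝ => (r : ℝ) • x + toReal w) '' P)

end GorensteinSimplex

/-!
The barycentric coordinates of a lattice simplex with vertices `v 0, …, v d` identify its group
`Λ` with the quotient of `ℤ^d` by the lattice generated by the edge vectors (`range_latticeHom`,
`ker_latticeHom`). Hence the order of `Λ` is the absolute value of the determinant of the edge
vectors, which is the normalized volume (`card_vertexGroup_eq_normalizedVolume`); here it is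
`p ^ 2`.

Let `m k` be the exponent of the projection of `Λ` to the `k`-th coordinate, so that `m k` times
the `k`-th barycentric coordinate is, up to a constant, a primitive integral form on `ℤ^d`. If
`m k = 1`, then `v k` has lattice distance `1` from the opposite facet and the simplex is a
lattice pyramid with apex `v k` (`isLatticePyramid_hull`). A lattice simplex is reflexive if and
only if the origin is an interior point at lattice distance `1` from all facets
(`isReflexive_hull_iff`); applied to `r Δ + w`, this says that `Δ` is Gorenstein of index `r` if
and only if `(1 / m 0, …, 1 / m d)` belongs to `Λ` and has sum `r`
(`isGorensteinOfIndex_hull_iff`).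

What remains is group theory. Every `m k` divides `p ^ 2` and differs from `1`. If some `m k` is
`p ^ 2`, then the vector of the `1 / m k` has order `p ^ 2` and generates `Λ`, which is the first
case (`exists_cyclic_generator`). Otherwise `Λ` is a plane over `ℤ/p` that contains the all-ones
vector; a second basis vector with a zero coordinate, scaled and reordered, together with its
difference from the all-ones vector gives the generators of the second case
(`exists_noncyclic_generators`). Conversely, the generators exhibit the vector of the `1 / m k` in
both cases.
-/

namespace GorensteinSimplex

/-! ### Lattice points and barycentric coordinates -/

section Lattice

variable {d : ℕ}

@[simp] lemma toReal_apply (x : Fin d → ℤ) (j : Fin d) : toReal x j = (x j : ℝ) := rfl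

@[simp] lemma toReal_zero : toReal (0 : Fin d → ℤ) = 0 := by ext j; simp

lemma toReal_add (x y : Fin d → ℤ) : toReal (x + y) = toReal x + toReal y := by ext j; simp

lemma toReal_sub (x y : Fin d → ℤ) : toReal (x - y) = toReal x - toReal y := by ext j; simp

lemma toReal_smul (n : ℤ) (x : Fin d → ℤ) : toReal (n • x) = (n : ℝ) • toReal x := by ext j; simp

lemma toReal_sum {ι : Type*} (s : Finset ι) (f : ι → Fin d → ℤ) :
    toReal (∑ i ∈ s, f i) = ∑ i ∈ s, toReal (f i) := by ext j; simp [Finset.sum_apply]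

lemma toReal_injective : Function.Injective (toReal : (Fin d → ℤ) → Fin d → ℝ) := by
  intro x y h
  ext j
  have hj := congrFun h j
  rwa [toReal_apply, toReal_apply, Int.cast_inj] at hj

lemma toReal_dotProduct (x y : Fin d → ℤ) : toReal x ⬝ᵥ toReal y = ((x ⬝ᵥ y : ℤ) : ℝ) := by
  simp [dotProduct]

end Lattice

section Barycentric

variable {d : ℕ} {v : Fin (d + 1) → Fin d → ℤ}

/-- The vertices of a lattice simplex as an affine basis of `ℝ^d`. Its coordinate functions are the
barycentric coordinates of the simplex. -/
noncomputable def vertexBasis (hv : AreSimplexVertices v) :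
    AffineBasis (Fin (d + 1)) ℝ (Fin d → ℝ) where
  toFun := fun i => toReal (v i)
  ind' := hv
  tot' := by
    rw [AffineIndependent.affineSpan_eq_top_iff_card_eq_finrank_add_one hv]
    simp

@[simp] lemma vertexBasis_apply (hv : AreSimplexVertices v) (i : Fin (d + 1)) :
    vertexBasis hv i = toReal (v i) := rfl

lemma hull_eq_nonneg_coord (hv : AreSimplexVertices v) :
    hull v = {x | ∀ i, 0 ≤ (vertexBasis hv).coord i x} :=
  (vertexBasis hv).convexHull_eq_nonneg_coord

lemma interior_hull (hv : AreSimplexVertices v) :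
    interior (hull v) = {x | ∀ i, 0 < (vertexBasis hv).coord i x} :=
  (vertexBasis hv).interior_convexHull

lemma sum_coord_smul (hv : AreSimplexVertices v) (x : Fin d → ℝ) :
    ∑ i, (vertexBasis hv).coord i x • toReal (v i) = x :=
  (vertexBasis hv).linear_combination_coord_eq_self x

lemma sum_coord (hv : AreSimplexVertices v) (x : Fin d → ℝ) :
    ∑ i, (vertexBasis hv).coord i x = 1 :=
  (vertexBasis hv).sum_coord_apply_eq_one x

lemma coord_vertex (hv : AreSimplexVertices v) (i k : Fin (d + 1)) :
    (vertexBasis hv).coord k (toReal (v i)) = if k = i then 1 else 0 :=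
  (vertexBasis hv).coord_apply k i

/-- Barycentric coordinates are unique. -/
lemma coord_eq_of_sum_smul_eq (hv : AreSimplexVertices v) {a : Fin (d + 1) → ℝ} {x : Fin d → ℝ}
    (ha : ∑ i, a i = 1) (hx : ∑ i, a i • toReal (v i) = x) (k : Fin (d + 1)) :
    (vertexBasis hv).coord k x = a k := by
  have h := (vertexBasis hv).coord_apply_combination_of_mem (Finset.mem_univ k) ha
  rwa [Finset.univ.affineCombination_eq_linear_combination _ _ ha,
    show ∑ i, a i • vertexBasis hv i = x from hx] at h

/-- The linear part of the `k`-th barycentric coordinate of a lattice simplex. -/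
noncomputable def coordForm (hv : AreSimplexVertices v) (k : Fin (d + 1)) :
    (Fin d → ℝ) →ₗ[ℝ] ℝ := ((vertexBasis hv).coord k).linear

lemma coordForm_sub (hv : AreSimplexVertices v) (k : Fin (d + 1)) (x y : Fin d → ℝ) :
    coordForm hv k (x - y) = (vertexBasis hv).coord k x - (vertexBasis hv).coord k y :=
  ((vertexBasis hv).coord k).linearMap_vsub x y

lemma coordForm_apply (hv : AreSimplexVertices v) (k : Fin (d + 1)) (x : Fin d → ℝ) :
    coordForm hv k x = (vertexBasis hv).coord k x - (vertexBasis hv).coord k 0 := by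
  rw [← coordForm_sub, sub_zero]

lemma coordForm_vertex_sub (hv : AreSimplexVertices v) (k i j : Fin (d + 1)) :
    coordForm hv k (toReal (v i - v j)) = (if k = i then 1 else 0) - if k = j then 1 else 0 := by
  rw [toReal_sub, coordForm_sub, coord_vertex, coord_vertex]

lemma sum_coordForm (hv : AreSimplexVertices v) (x : Fin d → ℝ) :
    ∑ k, coordForm hv k x = 0 := by
  simp only [coordForm_apply, Finset.sum_sub_distrib, sum_coord, sub_self]

lemma sum_coordForm_smul (hv : AreSimplexVertices v) (x : Fin d → ℝ) :
    ∑ k, coordForm hv k x • toReal (v k) = x := by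
  simp only [coordForm_apply, sub_smul, Finset.sum_sub_distrib, sum_coord_smul, sub_zero]

/-- A vector is determined by the linear parts of its barycentric coordinates. -/
lemma coordForm_ext (hv : AreSimplexVertices v) {x : Fin d → ℝ} {a : Fin (d + 1) → ℝ}
    (ha : ∑ k, a k = 0) (hx : ∑ k, a k • toReal (v k) = x) (k : Fin (d + 1)) :
    coordForm hv k x = a k := by
  rw [coordForm_apply, sub_eq_iff_eq_add]
  refine coord_eq_of_sum_smul_eq hv (a := fun k => a k + (vertexBasis hv).coord k 0) ?_ ?_ k
  · rw [Finset.sum_add_distrib, ha, sum_coord, zero_add]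
  · simp only [add_smul, Finset.sum_add_distrib, hx, sum_coord_smul, add_zero]

/-- The vertices of a `d`-dimensional simplex span `ℝ^d`, so only the zero vector is orthogonal to
all of them. -/
lemma eq_zero_of_forall_dotProduct_eq_zero (hv : AreSimplexVertices v) {y : Fin d → ℝ}
    (h : ∀ i, toReal (v i) ⬝ᵥ y = 0) : y = 0 := by
  rw [← dotProduct_eq_zero_iff]
  intro x
  rw [dotProduct_comm, ← sum_coord_smul hv x, sum_dotProduct]
  exact Finset.sum_eq_zero fun i _ => by rw [smul_dotProduct, h, smul_zero]

end Barycentric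

/-! ### The group of a simplex -/

section Group

variable {d : ℕ} {v : Fin (d + 1) → Fin d → ℤ}

lemma exists_torusClass_eq (l : Fin (d + 1) → UnitAddCircle) : ∃ x, torusClass x = l := by
  choose x hx using fun i => QuotientAddGroup.mk_surjective (l i)
  exact ⟨x, funext hx⟩

lemma coe_circle_eq_zero_iff {x : ℝ} : (x : UnitAddCircle) = 0 ↔ ∃ n : ℤ, x = n := by
  rw [AddCircle.coe_eq_zero_iff]
  simp [eq_comm]

lemma torusClass_mem_vertexGroup {x : Fin (d + 1) → ℝ} :
    torusClass x ∈ vertexGroup v ↔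
      (∃ z : Fin d → ℤ, ∑ i, x i • toReal (v i) = toReal z) ∧ ∃ t : ℤ, ∑ i, x i = t := by
  have h1 : torusClass x ∈ vertexGroup v ↔
      (∀ j : Fin d, ∑ i, v i j • (x i : UnitAddCircle) = 0) ∧ ∑ i, (x i : UnitAddCircle) = 0 :=
    Iff.rfl
  have h2 : ∀ j : Fin d, ∑ i, v i j • (x i : UnitAddCircle)
      = ((∑ i, x i * v i j : ℝ) : UnitAddCircle) := by
    intro j
    rw [show ((∑ i, x i * v i j : ℝ) : UnitAddCircle) = ∑ i, ((x i * v i j : ℝ) : UnitAddCircle)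
      from QuotientAddGroup.mk_sum _ _]
    refine Finset.sum_congr rfl fun i _ => ?_
    rw [mul_comm, ← zsmul_eq_mul]
    rfl
  have h3 : ∑ i, (x i : UnitAddCircle) = ((∑ i, x i : ℝ) : UnitAddCircle) :=
    (QuotientAddGroup.mk_sum _ _).symm
  rw [h1, h3]
  simp only [h2, coe_circle_eq_zero_iff]
  refine and_congr_left fun _ => ?_
  rw [Classical.skolem]
  refine exists_congr fun z => ?_
  rw [funext_iff]
  simp [Finset.sum_apply]

/-- The homomorphism from the lattice `ℤ^d` to the torus sending a lattice point to the class of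
the linear parts of its barycentric coordinates. -/
noncomputable def latticeHom (hv : AreSimplexVertices v) :
    (Fin d → ℤ) →+ (Fin (d + 1) → UnitAddCircle) where
  toFun x := torusClass fun k => coordForm hv k (toReal x)
  map_zero' := by ext k; simp [torusClass]
  map_add' x y := by ext k; simp [torusClass, toReal_add]

lemma latticeHom_apply (hv : AreSimplexVertices v) (x : Fin d → ℤ) (k : Fin (d + 1)) :
    latticeHom hv x k = (coordForm hv k (toReal x) : UnitAddCircle) := rfl

/-- The group of a simplex consists of the classes of the lattice points: subtracting an integral
multiple of a vertex moves a point at height `t` of the cone over the simplex to height `0`. -/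
lemma range_latticeHom (hv : AreSimplexVertices v) : (latticeHom hv).range = vertexGroup v := by
  ext l
  constructor
  · rintro ⟨x, rfl⟩
    exact torusClass_mem_vertexGroup.2
      ⟨⟨x, sum_coordForm_smul hv _⟩, 0, by rw [sum_coordForm, Int.cast_zero]⟩
  · intro hl
    obtain ⟨a, rfl⟩ := exists_torusClass_eq l
    obtain ⟨⟨z, hz⟩, t, ht⟩ := torusClass_mem_vertexGroup.1 hl
    refine ⟨z - t • v 0, funext fun k => ?_⟩
    have hk : coordForm hv k (toReal (z - t • v 0)) = a k - if k = 0 then (t : ℝ) else 0 := by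
      refine coordForm_ext hv (a := fun k => a k - if k = 0 then (t : ℝ) else 0) ?_ ?_ k
      · simp [ht]
      · simp only [sub_smul, Finset.sum_sub_distrib, hz, toReal_sub, toReal_smul, ite_smul,
          zero_smul, Finset.sum_ite_eq', Finset.mem_univ, if_true]
    rw [latticeHom_apply, hk]
    split_ifs
    · rw [AddCircle.coe_sub, (coe_circle_eq_zero_iff (x := (t : ℝ))).2 ⟨t, rfl⟩, sub_zero]
      rfl
    · rw [sub_zero]; rfl

/-- The edge vectors `v i - v 0`. -/
def edge (v : Fin (d + 1) → Fin d → ℤ) (i : Fin d) : Fin d → ℤ := v i.succ - v 0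

lemma linearIndependent_edge (hv : AreSimplexVertices v) : LinearIndependent ℤ (edge v) := by
  rw [Fintype.linearIndependent_iff]
  intro g hg i
  have h := congrArg (coordForm hv i.succ) (congrArg toReal hg)
  simp only [toReal_sum, toReal_smul, map_sum, map_smul, edge, coordForm_vertex_sub,
    Fin.succ_inj, Fin.succ_ne_zero, toReal_zero, map_zero] at h
  simpa using h

/-- The lattice points at which the linear parts of all barycentric coordinates are integral form
the sublattice generated by the edge vectors, whose index is a determinant. -/
lemma ker_latticeHom (hv : AreSimplexVertices v) :
    (latticeHom hv).ker = (Submodule.span ℤ (Set.range (edge v))).toAddSubgroup := by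
  ext x
  rw [AddMonoidHom.mem_ker, Submodule.mem_toAddSubgroup, Submodule.mem_span_range_iff_exists_fun]
  constructor
  · intro hx
    have hx' : ∀ k, ∃ n : ℤ, coordForm hv k (toReal x) = n := fun k =>
      coe_circle_eq_zero_iff.1 (congrFun hx k)
    choose n hn using hx'
    refine ⟨fun i => n i.succ, toReal_injective ?_⟩
    have h0 := sum_coordForm hv (toReal x)
    have h1 := sum_coordForm_smul hv (toReal x)
    rw [Fin.sum_univ_succ] at h0 h1
    rw [eq_neg_of_add_eq_zero_left h0] at h1
    rw [toReal_sum, ← h1]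
    simp only [toReal_smul, edge, toReal_sub, smul_sub, Finset.sum_sub_distrib, hn, neg_smul,
      Finset.sum_smul]
    abel
  · rintro ⟨c, rfl⟩
    ext k
    rw [latticeHom_apply, Pi.zero_apply, coe_circle_eq_zero_iff]
    refine ⟨∑ i, c i * ((if k = i.succ then 1 else 0) - if k = 0 then 1 else 0), ?_⟩
    simp only [toReal_sum, toReal_smul, map_sum, map_smul, edge, coordForm_vertex_sub, smul_eq_mul]
    push_cast
    rfl

lemma card_vertexGroup (hv : AreSimplexVertices v) :
    Nat.card (vertexGroup v) = (Matrix.det (Matrix.of (edge v))).natAbs := by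
  rw [← range_latticeHom hv,
    ← Nat.card_congr (QuotientAddGroup.quotientKerEquivRange (latticeHom hv)).toEquiv]
  change (latticeHom hv).ker.index = _
  rw [ker_latticeHom hv]
  have h := AddSubgroup.index_eq_natAbs_det (Pi.basisFun ℤ (Fin d))
    (Submodule.span ℤ (Set.range (edge v))).toAddSubgroup
    (Module.Basis.span (linearIndependent_edge hv))
  rw [h, Module.Basis.det_apply, ← Matrix.det_transpose]
  congr 2
  ext i j
  rw [Matrix.transpose_apply, Module.Basis.toMatrix_apply, Pi.basisFun_repr]
  exact congrFun (congrArg Subtype.val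
    (Module.Basis.span_apply (linearIndependent_edge hv) i)) j

end Group

/-! ### The volume of a simplex -/

/-- The corner simplex `{x ≥ 0, ∑ x ≤ 1}`. -/
def cornerSimplex (d : ℕ) : Set (Fin d → ℝ) := {x | (∀ i, 0 ≤ x i) ∧ ∑ i, x i ≤ 1}

lemma measurableSet_cornerSimplex (d : ℕ) : MeasurableSet (cornerSimplex d) := by
  refine IsClosed.measurableSet ?_
  refine IsClosed.inter (s₁ := {x : Fin d → ℝ | ∀ i, 0 ≤ x i}) ?_ ?_
  · simp only [Set.ofPred_forall]
    exact isClosed_iInter fun i => isClosed_le continuous_const (continuous_apply i)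
  · exact isClosed_le (f := fun x : Fin d → ℝ => ∑ i, x i) (by fun_prop) continuous_const

open scoped Pointwise in
/-- The slice of the corner simplex at height `t < 1` is the `(1 - t)`-fold of the corner simplex
one dimension lower. -/
lemma cornerSimplex_slice {d : ℕ} {t : ℝ} (h0 : 0 ≤ t) (h1 : t < 1) :
    {x : Fin d → ℝ | (Fin.cons t x : Fin (d + 1) → ℝ) ∈ cornerSimplex (d + 1)} =
      (1 - t) • cornerSimplex d := by
  have ht : 0 < 1 - t := by linarith
  ext x
  rw [Set.mem_smul_set_iff_inv_smul_mem₀ ht.ne']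
  simp only [cornerSimplex, Set.mem_ofPred_eq, Fin.forall_fin_succ, Fin.cons_zero, Fin.cons_succ,
    Fin.sum_univ_succ, h0, true_and, Pi.smul_apply, smul_eq_mul, ← Finset.mul_sum]
  refine and_congr (forall_congr' fun i => ?_) ?_
  · rw [mul_nonneg_iff_of_pos_left (inv_pos.2 ht)]
  · rw [inv_mul_le_iff₀ ht]
    constructor <;> intro h <;> linarith

open scoped Pointwise in
/-- By Fubini over the slices, the induction step is `∫ (1 - t)^d / d! = 1 / (d + 1)!`. -/
lemma volume_cornerSimplex (d : ℕ) :
    volume (cornerSimplex d) = ENNReal.ofReal (1 / (d.factorial : ℝ)) := by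
  induction d with
  | zero =>
    have : cornerSimplex 0 = Set.univ := by ext x; simp [cornerSimplex]
    rw [this, volume_pi, Measure.pi_univ]
    simp
  | succ d ih =>
    have hmp := (volume_preserving_piFinSuccAbove (fun _ : Fin (d + 1) => ℝ) 0).symm
    rw [← hmp.measure_preimage (measurableSet_cornerSimplex (d + 1)).nullMeasurableSet,
      Measure.volume_eq_prod, Measure.prod_apply
        ((MeasurableEquiv.measurable _) (measurableSet_cornerSimplex (d + 1)))]
    have hslice : ∀ t : ℝ, (Prod.mk t ⁻¹'
        ((MeasurableEquiv.piFinSuccAbove (fun _ : Fin (d + 1) => ℝ) 0).symm ⁻¹'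
          cornerSimplex (d + 1))) =
        {x : Fin d → ℝ | (Fin.cons t x : Fin (d + 1) → ℝ) ∈ cornerSimplex (d + 1)} := by
      intro t
      ext x
      simp [MeasurableEquiv.piFinSuccAbove, Fin.insertNthEquiv]
    have hval : ∀ t : ℝ, t ≠ 1 → volume (Prod.mk t ⁻¹'
        ((MeasurableEquiv.piFinSuccAbove (fun _ : Fin (d + 1) => ℝ) 0).symm ⁻¹'
          cornerSimplex (d + 1))) =
        (Set.Icc (0 : ℝ) 1).indicator
          (fun t => ENNReal.ofReal ((1 - t) ^ d * (1 / (d.factorial : ℝ)))) t := by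
      intro t ht
      rw [hslice]
      by_cases htI : t ∈ Set.Icc (0 : ℝ) 1
      · have h1 : t < 1 := lt_of_le_of_ne htI.2 ht
        have h2 : 0 ≤ (1 - t) ^ d := pow_nonneg (by linarith) d
        rw [Set.indicator_of_mem htI, cornerSimplex_slice htI.1 h1, Measure.addHaar_smul, ih,
          Module.finrank_fin_fun, abs_of_nonneg h2, ENNReal.ofReal_mul h2]
      · rw [Set.indicator_of_notMem htI]
        convert measure_empty (μ := volume)
        rw [Set.eq_empty_iff_forall_notMem]
        rintro x ⟨hx0, hx1⟩
        refine htI ⟨by simpa using hx0 0, ?_⟩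
        have : 0 ≤ ∑ i : Fin d, x i :=
          Finset.sum_nonneg fun i _ => by simpa using hx0 i.succ
        rw [Fin.sum_univ_succ] at hx1
        simp only [Fin.cons_zero, Fin.cons_succ] at hx1
        linarith
    rw [lintegral_congr_ae ((Measure.ae_ne volume (1 : ℝ)).mono hval),
      lintegral_indicator measurableSet_Icc, ← ofReal_integral_eq_lintegral_ofReal]
    · congr 1
      rw [integral_Icc_eq_integral_Ioc, ← intervalIntegral.integral_of_le zero_le_one,
        intervalIntegral.integral_mul_const,
        intervalIntegral.integral_comp_sub_left (fun t => t ^ d) 1]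
      simp only [sub_self, sub_zero, integral_pow, Nat.factorial_succ]
      push_cast
      have : (d.factorial : ℝ) ≠ 0 := by positivity
      field_simp
      simp
    · exact (Continuous.integrableOn_Icc (by fun_prop))
    · filter_upwards [ae_restrict_mem measurableSet_Icc] with t ht
      have : 0 ≤ 1 - t := by linarith [ht.2]
      positivity

/-- A lattice simplex is the image of the corner simplex under the affine map given by its edge
vectors. -/
lemma hull_eq_image_cornerSimplex {d : ℕ} {v : Fin (d + 1) → Fin d → ℤ}
    (hv : AreSimplexVertices v) :
    hull v = (fun x => x + toReal (v 0)) ''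
      (Matrix.toLin' ((Matrix.of (edge v)).map (Int.cast : ℤ → ℝ))ᵀ '' cornerSimplex d) := by
  have hmul : ∀ t : Fin d → ℝ,
      Matrix.toLin' ((Matrix.of (edge v)).map (Int.cast : ℤ → ℝ))ᵀ t + toReal (v 0) =
        (1 - ∑ i, t i) • toReal (v 0) + ∑ i, t i • toReal (v i.succ) := by
    intro t
    have h : Matrix.toLin' ((Matrix.of (edge v)).map (Int.cast : ℤ → ℝ))ᵀ t =
        ∑ i, t i • (toReal (v i.succ) - toReal (v 0)) := by
      ext j
      simp [Matrix.mulVec, dotProduct, edge, Finset.sum_apply, mul_comm]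
    rw [h]
    simp only [smul_sub, Finset.sum_sub_distrib, sub_smul, one_smul, Finset.sum_smul]
    abel
  rw [Set.image_image, hull_eq_nonneg_coord hv]
  simp only [hmul]
  ext x
  constructor
  · intro hx
    have h1 := sum_coord hv x
    have h2 := sum_coord_smul hv x
    rw [Fin.sum_univ_succ] at h1 h2
    refine ⟨fun i => (vertexBasis hv).coord i.succ x, ⟨fun i => hx _, ?_⟩, ?_⟩
    · linarith [hx 0]
    · beta_reduce
      rw [← h1, add_sub_cancel_right, h2]
  · rintro ⟨t, ⟨ht0, ht1⟩, rfl⟩ k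
    rw [coord_eq_of_sum_smul_eq hv (a := Fin.cons (1 - ∑ i, t i) t)]
    · refine Fin.cases ?_ (fun i => ?_) k
      · simpa using ht1
      · simpa using ht0 i
    · simp [Fin.sum_univ_succ]
    · simp [Fin.sum_univ_succ]

lemma normalizedVolume_hull {d : ℕ} {v : Fin (d + 1) → Fin d → ℤ} (hv : AreSimplexVertices v) :
    normalizedVolume (hull v) = ((Matrix.det (Matrix.of (edge v))).natAbs : ℝ) := by
  have hdet : ((Matrix.of (edge v)).map (Int.cast : ℤ → ℝ)).det =
      ((Matrix.of (edge v)).det : ℝ) := (Int.cast_det _).symm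
  rw [normalizedVolume, hull_eq_image_cornerSimplex hv, measureReal_def, Set.image_add_right,
    measure_preimage_add_right, Measure.addHaar_image_linearMap, LinearMap.det_toLin',
    Matrix.det_transpose, hdet, volume_cornerSimplex, ENNReal.toReal_mul,
    ENNReal.toReal_ofReal (abs_nonneg _), ENNReal.toReal_ofReal (by positivity), Nat.cast_natAbs,
    Int.cast_abs]
  have : (d.factorial : ℝ) ≠ 0 := by positivity
  field_simp

/-- The order of the group of a lattice simplex is its normalized volume. -/
lemma card_vertexGroup_eq_normalizedVolume {d : ℕ} {v : Fin (d + 1) → Fin d → ℤ}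
    (hv : AreSimplexVertices v) : (Nat.card (vertexGroup v) : ℝ) = normalizedVolume (hull v) := by
  rw [card_vertexGroup hv, normalizedVolume_hull hv]

/-! ### Reflexive and Gorenstein simplices -/

section Dual

variable {d : ℕ} {v : Fin (d + 1) → Fin d → ℤ}

lemma mem_dual_hull {y : Fin d → ℝ} : y ∈ dual (hull v) ↔ ∀ i, toReal (v i) ⬝ᵥ y ≤ 1 := by
  constructor
  · exact fun h i => h _ (subset_convexHull ℝ _ ⟨i, rfl⟩)
  · intro h x hx
    have hconv : Convex ℝ {x : Fin d → ℝ | x ⬝ᵥ y ≤ 1} :=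
      convex_halfSpace_le ⟨fun a b => add_dotProduct a b y, fun c a => smul_dotProduct c a y⟩ 1
    refine convexHull_min ?_ hconv hx
    rintro _ ⟨i, rfl⟩
    exact h i

lemma isLatticePolytope_hull {n : ℕ} (v : Fin (n + 1) → Fin d → ℤ) :
    IsLatticePolytope (hull v) := by
  refine ⟨Finset.univ.image v, ⟨v 0, by simp⟩, ?_⟩
  rw [hull, Finset.coe_image, Finset.coe_univ, Set.image_univ, ← Set.range_comp]
  rfl

/-- If `y k` describes the `k`-th facet of a simplex around the origin, then a vertex `v i` pairs to
`1` with `y k` unless `i = k`. -/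
lemma dotProduct_facet (hv : AreSimplexVertices v) {y : Fin (d + 1) → Fin d → ℝ}
    (hc : ∀ k, 0 < (vertexBasis hv).coord k 0)
    (hy : ∀ k x, coordForm hv k x = -((vertexBasis hv).coord k 0 * (x ⬝ᵥ y k)))
    (i k : Fin (d + 1)) :
    toReal (v i) ⬝ᵥ y k = 1 - if k = i then ((vertexBasis hv).coord k 0)⁻¹ else 0 := by
  have h := hy k (toReal (v i))
  rw [coordForm_apply, coord_vertex] at h
  have hk := (hc k).ne'
  split_ifs at h ⊢
  · field_simp
    linarith
  · refine mul_left_cancel₀ hk ?_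
    linarith

/-- The dual of a simplex around the origin is the simplex spanned by the vectors that describe its
facets. -/
lemma dual_hull_eq (hv : AreSimplexVertices v) {y : Fin (d + 1) → Fin d → ℝ}
    (hc : ∀ k, 0 < (vertexBasis hv).coord k 0)
    (hy : ∀ k x, coordForm hv k x = -((vertexBasis hv).coord k 0 * (x ⬝ᵥ y k))) :
    dual (hull v) = convexHull ℝ (Set.range y) := by
  have hvy := dotProduct_facet hv hc hy
  have hzero := sum_coord_smul hv 0
  have hone := sum_coord hv 0
  set c := fun k => (vertexBasis hv).coord k 0 with hcdef
  apply Set.Subset.antisymm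
  · intro q hq
    rw [mem_dual_hull] at hq
    have hs : ∑ k, c k * (1 - toReal (v k) ⬝ᵥ q) = 1 := by
      have h0 : ∑ k, c k * (toReal (v k) ⬝ᵥ q) = 0 := by
        have := congrArg (fun x => x ⬝ᵥ q) hzero
        simpa [sum_dotProduct] using this
      simp only [mul_sub, mul_one, Finset.sum_sub_distrib, h0, sub_zero]
      exact hone
    -- the barycentric coordinates of `q` are its weighted slacks at the vertices of `v`
    have hq' : q = ∑ k, (c k * (1 - toReal (v k) ⬝ᵥ q)) • y k := by
      rw [← sub_eq_zero]
      refine eq_zero_of_forall_dotProduct_eq_zero hv fun i => ?_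
      rw [dotProduct_sub, dotProduct_sum]
      simp only [dotProduct_smul, hvy, smul_eq_mul, mul_sub (_ * _), mul_one,
        Finset.sum_sub_distrib, hs, mul_ite, mul_zero, Finset.sum_ite_eq', Finset.mem_univ, if_true]
      have : c i ≠ 0 := (hc i).ne'
      change _ - (1 - c i * (1 - toReal (v i) ⬝ᵥ q) * (c i)⁻¹) = 0
      field_simp
      ring
    rw [hq']
    refine (convex_convexHull ℝ _).sum_mem (fun k _ => ?_) hs
      fun k _ => subset_convexHull ℝ _ ⟨k, rfl⟩
    exact mul_nonneg (hc k).le (by linarith [hq k])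
  · refine convexHull_min ?_ ?_
    · rintro _ ⟨k, rfl⟩
      rw [mem_dual_hull]
      intro i
      rw [hvy]
      split_ifs
      · have := inv_pos.2 (hc k); linarith
      · linarith
    · have : dual (hull v) = ⋂ x ∈ hull v, {y | x ⬝ᵥ y ≤ 1} := by ext; simp [dual]
      rw [this]
      refine convex_iInter₂ fun x _ => ?_
      exact convex_halfSpace_le
        ⟨fun a b => dotProduct_add x a b, fun c a => dotProduct_smul c x a⟩ 1

/-- The vectors describing the facets are vertices of the dual, hence integral if the dual is a
lattice polytope. -/
lemma facet_mem_extremePoints (hv : AreSimplexVertices v) {y : Fin (d + 1) → Fin d → ℝ}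
    (hc : ∀ k, 0 < (vertexBasis hv).coord k 0)
    (hy : ∀ k x, coordForm hv k x = -((vertexBasis hv).coord k 0 * (x ⬝ᵥ y k)))
    (k : Fin (d + 1)) : y k ∈ Set.extremePoints ℝ (dual (hull v)) := by
  have hvy := dotProduct_facet hv hc hy
  rw [mem_extremePoints_iff_left]
  refine ⟨?_, ?_⟩
  · rw [dual_hull_eq hv hc hy]
    exact subset_convexHull ℝ _ ⟨k, rfl⟩
  · rintro a ha b hb ⟨s, t, hs, ht, hst, hab⟩
    rw [mem_dual_hull] at ha hb
    have hne : ∀ i, i ≠ k → toReal (v i) ⬝ᵥ (a - y k) = 0 := by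
      intro i hi
      have h1 := hvy i k
      rw [if_neg (Ne.symm hi), sub_zero] at h1
      have h2 := congrArg (fun q => toReal (v i) ⬝ᵥ q) hab
      simp only [dotProduct_add, dotProduct_smul, smul_eq_mul, h1] at h2
      rw [dotProduct_sub, h1]
      nlinarith [ha i, hb i]
    rw [← sub_eq_zero]
    refine eq_zero_of_forall_dotProduct_eq_zero hv fun i => ?_
    by_cases hi : i = k
    · have h0 := congrArg (fun x => x ⬝ᵥ (a - y k)) (sum_coord_smul hv 0)
      simp only [sum_dotProduct, smul_dotProduct, smul_eq_mul, zero_dotProduct] at h0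
      rw [Finset.sum_eq_single k (fun j _ hj => by rw [hne j hj, mul_zero]) (by simp)] at h0
      rw [hi]
      exact (mul_eq_zero.1 h0).resolve_left (hc k).ne'
    · exact hne i hi

/-- A lattice simplex is reflexive if and only if the origin is an interior point and each of its
facets lies in a hyperplane `⟨x, y⟩ = 1` with `y` integral. In barycentric terms, the
`k`-th coordinate is its value at the origin times `1 - ⟨x, y k⟩`. -/
theorem isReflexive_hull_iff (hv : AreSimplexVertices v) :
    IsReflexive (hull v) ↔ (∀ k, 0 < (vertexBasis hv).coord k 0) ∧
      ∃ y : Fin (d + 1) → Fin d → ℤ, ∀ k x,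
        coordForm hv k x = -((vertexBasis hv).coord k 0 * (x ⬝ᵥ toReal (y k))) := by
  constructor
  · rintro ⟨-, hint, S, -, hS⟩
    have hc : ∀ k, 0 < (vertexBasis hv).coord k 0 := by
      have := (hint 0).2 rfl
      rwa [interior_hull hv, toReal_zero] at this
    refine ⟨hc, ?_⟩
    let y : Fin (d + 1) → Fin d → ℝ := fun k j =>
      -(coordForm hv k (Pi.single j 1) / (vertexBasis hv).coord k 0)
    have hy : ∀ k x, coordForm hv k x = -((vertexBasis hv).coord k 0 * (x ⬝ᵥ y k)) := by
      intro k x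
      have := (hc k).ne'
      rw [LinearMap.pi_apply_eq_sum_univ (coordForm hv k) x, dotProduct, Finset.mul_sum,
        ← Finset.sum_neg_distrib]
      refine Finset.sum_congr rfl fun j _ => ?_
      have hj : (fun i => if j = i then (1 : ℝ) else 0) = Pi.single j 1 := by
        ext i; simp [Pi.single_apply, eq_comm]
      rw [hj, smul_eq_mul]
      simp only [y]
      field_simp
    have hex : ∀ k, ∃ z : Fin d → ℤ, toReal z = y k := by
      intro k
      have h := facet_mem_extremePoints hv hc hy k
      rw [hS] at h
      obtain ⟨z, -, hz⟩ := extremePoints_convexHull_subset h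
      exact ⟨z, hz⟩
    choose z hz using hex
    exact ⟨z, fun k x => by rw [hz, hy]⟩
  · rintro ⟨hc, y, hy⟩
    refine ⟨isLatticePolytope_hull v, fun z => ?_, ?_⟩
    · rw [interior_hull hv]
      constructor
      · intro hz
        -- an interior lattice point has barycentric coordinates at least those of the origin
        have hle : ∀ k, (vertexBasis hv).coord k 0 ≤ (vertexBasis hv).coord k (toReal z) := by
          intro k
          have h1 := hz k
          have h2 := coordForm_apply hv k (toReal z)
          rw [hy, toReal_dotProduct] at h2
          have h3 : 0 < (vertexBasis hv).coord k 0 * (1 - ((z ⬝ᵥ y k : ℤ) : ℝ)) := by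
            linarith
          have h4 : z ⬝ᵥ y k < 1 := by
            have := (mul_pos_iff_of_pos_left (hc k)).1 h3
            have h5 : ((z ⬝ᵥ y k : ℤ) : ℝ) < 1 := by linarith
            exact_mod_cast h5
          have h6 : ((z ⬝ᵥ y k : ℤ) : ℝ) ≤ 0 := by exact_mod_cast Int.lt_add_one_iff.1 h4
          nlinarith [hc k]
        have heq := (Finset.sum_eq_sum_iff_of_le fun k _ => hle k).1
          ((sum_coord hv 0).trans (sum_coord hv (toReal z)).symm)
        apply toReal_injective
        rw [toReal_zero]
        exact (vertexBasis hv).ext_elem fun k => (heq k (Finset.mem_univ k)).symm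
      · rintro rfl
        rw [toReal_zero]
        exact hc
    · rw [dual_hull_eq hv hc hy]
      exact isLatticePolytope_hull y

end Dual

section Gorenstein

variable {d : ℕ} {v : Fin (d + 1) → Fin d → ℤ}

/-- The vertices of `r P + w`, where `P` has the vertices `v`. -/
def dilate (r : ℕ) (w : Fin d → ℤ) (v : Fin (d + 1) → Fin d → ℤ) (i : Fin (d + 1)) : Fin d → ℤ :=
  (r : ℤ) • v i + w

lemma toReal_dilate (r : ℕ) (w : Fin d → ℤ) (i : Fin (d + 1)) :
    toReal (dilate r w v i) = (r : ℝ) • toReal (v i) + toReal w := by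
  rw [dilate, toReal_add, toReal_smul, Int.cast_natCast]

/-- The affine map `x ↦ r x + w`. -/
noncomputable def dilation (r : ℕ) (w : Fin d → ℤ) : (Fin d → ℝ) →ᵃ[ℝ] (Fin d → ℝ) :=
  (r : ℝ) • AffineMap.id ℝ (Fin d → ℝ) + AffineMap.const ℝ (Fin d → ℝ) (toReal w)

lemma dilation_apply (r : ℕ) (w : Fin d → ℤ) (x : Fin d → ℝ) :
    dilation r w x = (r : ℝ) • x + toReal w := by
  simp [dilation]

lemma hull_dilate (r : ℕ) (w : Fin d → ℤ) :
    hull (dilate r w v) = (fun x : Fin d → ℝ => (r : ℝ) • x + toReal w) '' hull v := by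
  have : (fun x : Fin d → ℝ => (r : ℝ) • x + toReal w) = dilation r w := by
    ext1 x; rw [dilation_apply]
  rw [this, hull, hull, AffineMap.image_convexHull, ← Set.range_comp]
  congr 2
  ext1 i
  rw [Function.comp_apply, dilation_apply, toReal_dilate]

lemma AreSimplexVertices.dilate (hv : AreSimplexVertices v) {r : ℕ} (hr : 0 < r)
    (w : Fin d → ℤ) : AreSimplexVertices (dilate r w v) := by
  have h : Function.Injective (dilation r w) := by
    intro x y hxy
    rw [dilation_apply, dilation_apply, add_left_inj] at hxy
    exact smul_right_injective _ (Nat.cast_ne_zero.2 hr.ne') hxy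
  have := AffineIndependent.map' hv (dilation r w) h
  have heq : (fun i => toReal (GorensteinSimplex.dilate r w v i)) =
      dilation r w ∘ fun i => toReal (v i) := by
    ext1 i
    rw [Function.comp_apply, dilation_apply, toReal_dilate]
  rwa [AreSimplexVertices, heq]

lemma coordForm_dilate (hv : AreSimplexVertices v) {r : ℕ} (hr : 0 < r) (w : Fin d → ℤ)
    (k : Fin (d + 1)) (x : Fin d → ℝ) :
    coordForm (hv.dilate hr w) k x = coordForm hv k x / r := by
  have hr' : (r : ℝ) ≠ 0 := Nat.cast_ne_zero.2 hr.ne'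
  refine coordForm_ext (hv.dilate hr w) (a := fun k => coordForm hv k x / r) ?_ ?_ k
  · rw [← Finset.sum_div, sum_coordForm, zero_div]
  · simp only [toReal_dilate, smul_add, Finset.sum_add_distrib, smul_smul, div_mul_cancel₀ _ hr',
      sum_coordForm_smul, ← Finset.sum_smul, ← Finset.sum_div, sum_coordForm, zero_div, zero_smul,
      add_zero]

/-- A lattice simplex is Gorenstein of index `r` if and only if the reciprocals of the exponents
`m k` of the coordinate projections of its group form an element of that group with sum `r`. That
`m k` is the exact exponent of the `k`-th projection follows from the membership, so that it is
enough that `m k` annihilates it. -/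
theorem isGorensteinOfIndex_hull_iff (hv : AreSimplexVertices v) (hd : d ≠ 0) (r : ℕ) :
    IsGorensteinOfIndex r (hull v) ↔ 0 < r ∧ ∃ m : Fin (d + 1) → ℕ, (∀ k, 0 < m k) ∧
      ∑ k, (m k : ℝ)⁻¹ = r ∧ torusClass (fun k => (m k : ℝ)⁻¹) ∈ vertexGroup v ∧
      ∀ l ∈ vertexGroup v, ∀ k, m k • l k = 0 := by
  rw [IsGorensteinOfIndex]
  refine and_congr_right fun hr => ?_
  have hr' : (0 : ℝ) < r := Nat.cast_pos.2 hr
  simp only [isLatticePolytope_hull v, true_and, ← hull_dilate,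
    isReflexive_hull_iff (hv.dilate hr _), coordForm_dilate hv hr]
  constructor
  · rintro ⟨w, hc, y, hy⟩
    set c := fun k => (vertexBasis (hv.dilate hr w)).coord k 0 with hcdef
    have hform : ∀ k (x : Fin d → ℤ),
        coordForm hv k (toReal x) = -(r * c k * ((x ⬝ᵥ y k : ℤ) : ℝ)) := by
      intro k x
      have h := hy k (toReal x)
      rw [toReal_dotProduct, div_eq_iff hr'.ne'] at h
      rw [h]
      ring
    -- evaluating at an edge from another vertex: `r * c k` is the reciprocal of an integer
    have hm : ∀ k, ∃ m : ℕ, 0 < m ∧ (r * c k) * m = 1 := by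
      intro k
      have : Nontrivial (Fin (d + 1)) := Fin.nontrivial_iff_two_le.2 (by omega)
      obtain ⟨i, hi⟩ := exists_ne k
      have h := hform k (v k - v i)
      rw [coordForm_vertex_sub, if_pos rfl, if_neg hi.symm, sub_zero] at h
      have hpos : 0 < -((v k - v i) ⬝ᵥ y k) := by
        have h1 : 0 < (r * c k) * ((-((v k - v i) ⬝ᵥ y k) : ℤ) : ℝ) := by
          push_cast at h ⊢; linarith
        have h2 := (mul_pos_iff_of_pos_left (mul_pos hr' (hc k))).1 h1
        exact_mod_cast h2
      obtain ⟨n, hn⟩ := Int.eq_ofNat_of_zero_le hpos.le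
      refine ⟨n, by omega, ?_⟩
      have : (n : ℝ) = ((-((v k - v i) ⬝ᵥ y k) : ℤ) : ℝ) := by rw [hn]; simp
      rw [this]
      push_cast at h ⊢
      linarith
    choose m hm0 hm1 using hm
    have hminv : ∀ k, (m k : ℝ)⁻¹ = r * c k := fun k => (eq_inv_of_mul_eq_one_left (hm1 k)).symm
    refine ⟨m, hm0, ?_, ?_, ?_⟩
    · simp only [hminv, ← Finset.mul_sum]
      rw [sum_coord, mul_one]
    · refine torusClass_mem_vertexGroup.2 ⟨⟨-w, ?_⟩, r, ?_⟩
      · have h := sum_coord_smul (hv.dilate hr w) 0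
        simp only [toReal_dilate, smul_add, Finset.sum_add_distrib, smul_smul,
          ← Finset.sum_smul, sum_coord, one_smul] at h
        simp only [hminv]
        rw [show toReal (-w) = -toReal w by ext j; simp, ← eq_neg_of_add_eq_zero_left h]
        simp only [mul_comm, hcdef]
      · simp only [hminv, ← Finset.mul_sum]
        rw [sum_coord, mul_one, Int.cast_natCast]
    · intro l hl k
      rw [← range_latticeHom hv] at hl
      obtain ⟨x, rfl⟩ := hl
      rw [latticeHom_apply, hform, ← AddCircle.coe_nsmul, coe_circle_eq_zero_iff]
      refine ⟨-(x ⬝ᵥ y k), ?_⟩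
      rw [nsmul_eq_mul]
      push_cast
      linear_combination (-((x ⬝ᵥ y k : ℤ) : ℝ)) * hm1 k
  · rintro ⟨m, hm0, hsum, hmem, hkill⟩
    obtain ⟨⟨z, hz⟩, -⟩ := torusClass_mem_vertexGroup.1 hmem
    have hc : ∀ k, (vertexBasis (hv.dilate hr (-z))).coord k 0 = (m k : ℝ)⁻¹ / r := by
      refine coord_eq_of_sum_smul_eq _ ?_ ?_
      · rw [← Finset.sum_div, hsum, div_self hr'.ne']
      · simp only [toReal_dilate, smul_add, Finset.sum_add_distrib, smul_smul,
          div_mul_cancel₀ _ hr'.ne', ← Finset.sum_smul, ← Finset.sum_div, hsum, div_self hr'.ne',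
          one_smul, hz]
        rw [← toReal_add, add_neg_cancel, toReal_zero]
    refine ⟨-z, fun k => ?_, ?_⟩
    · rw [hc]
      have := hm0 k
      positivity
    · have hint : ∀ k (j : Fin d), ∃ n : ℤ, (m k : ℝ) * coordForm hv k (Pi.single j 1) = n := by
        intro k j
        have h := hkill (latticeHom hv (Pi.single j 1))
          (by rw [← range_latticeHom hv]; exact ⟨_, rfl⟩) k
        rw [latticeHom_apply, ← AddCircle.coe_nsmul, coe_circle_eq_zero_iff, nsmul_eq_mul,
          show toReal (Pi.single j (1 : ℤ)) = Pi.single j (1 : ℝ) by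
            ext i; by_cases h : i = j <;> simp [h]] at h
        exact h
      choose n hn using hint
      refine ⟨fun k j => -n k j, fun k x => ?_⟩
      have hmk : (m k : ℝ) ≠ 0 := Nat.cast_ne_zero.2 (hm0 k).ne'
      rw [hc, LinearMap.pi_apply_eq_sum_univ (coordForm hv k) x, dotProduct, Finset.mul_sum,
        ← Finset.sum_neg_distrib, Finset.sum_div]
      refine Finset.sum_congr rfl fun j _ => ?_
      have hj : (fun i => if j = i then (1 : ℝ) else 0) = Pi.single j 1 := by
        ext i; simp [Pi.single_apply, eq_comm]
      rw [hj, smul_eq_mul, toReal_apply, Int.cast_neg, ← hn]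
      field_simp

end Gorenstein

/-! ### Lattice pyramids -/

/-- The inclusion `x ↦ (x, 0)`. -/
def snocZero (n : ℕ) : (Fin n → ℝ) →ₗ[ℝ] (Fin (n + 1) → ℝ) where
  toFun x := Fin.snoc x (0 : ℝ)
  map_add' x y := by
    ext i
    refine Fin.lastCases ?_ (fun j => ?_) i <;> simp
  map_smul' c x := by
    ext i
    refine Fin.lastCases ?_ (fun j => ?_) i <;> simp

/-- The affine map `x ↦ x U + w` of an integral matrix and an integral vector. -/
noncomputable def vecMulAdd {n : ℕ} (U : Matrix (Fin n) (Fin n) ℤ) (w : Fin n → ℤ) :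
    (Fin n → ℝ) →ᵃ[ℝ] (Fin n → ℝ) :=
  (Matrix.vecMulLinear (U.map (fun z : ℤ => (z : ℝ)))).toAffineMap +
    AffineMap.const ℝ (Fin n → ℝ) (toReal w)

lemma vecMulAdd_apply {n : ℕ} (U : Matrix (Fin n) (Fin n) ℤ) (w : Fin n → ℤ) (x : Fin n → ℝ) :
    vecMulAdd U w x = x ᵥ* U.map (fun z : ℤ => (z : ℝ)) + toReal w := by
  simp [vecMulAdd]

/-- An integral matrix whose rows form a lattice basis has determinant `±1`. -/
lemma det_of_basis {n : ℕ} (B : Module.Basis (Fin n) ℤ (Fin n → ℤ)) :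
    (Matrix.of fun i => B i).det = 1 ∨ (Matrix.of fun i => B i).det = -1 := by
  have h := (Pi.basisFun ℤ (Fin n)).isUnit_det B
  rw [Module.Basis.det_apply, ← Matrix.det_transpose] at h
  exact Int.isUnit_iff.1 h

/-- A linear form on `ℤ^(n+1)` with value `1` at `e` has a kernel with a basis which `e` completes
to a basis of `ℤ^(n+1)`. -/
lemma exists_basis_snoc {n : ℕ} (f : (Fin (n + 1) → ℤ) →ₗ[ℤ] ℤ) {e : Fin (n + 1) → ℤ}
    (he : f e = 1) :
    ∃ (b : Module.Basis (Fin n) ℤ (LinearMap.ker f))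
      (B : Module.Basis (Fin (n + 1)) ℤ (Fin (n + 1) → ℤ)),
      (∀ i, B (Fin.castSucc i) = b i) ∧ B (Fin.last n) = e := by
  have hli : ∀ (c : ℤ), ∀ x ∈ LinearMap.ker f, c • e + x = 0 → c = 0 := by
    intro c x hx h
    have := congrArg f h
    rw [map_add, map_smul, he, LinearMap.mem_ker.1 hx, map_zero] at this
    simpa using this
  have hsp : ∀ z, ∃ c : ℤ, z + c • e ∈ LinearMap.ker f := fun z =>
    ⟨-f z, by rw [LinearMap.mem_ker, map_add, map_smul, he]; simp⟩
  have hrank : Module.finrank ℤ (LinearMap.ker f) = n := by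
    have h := Module.finrank_eq_card_basis
      (Module.Basis.mkFinCons e (Module.finBasis ℤ (LinearMap.ker f)) hli hsp)
    simp only [Module.finrank_fin_fun, Fintype.card_fin] at h
    omega
  let b : Module.Basis (Fin n) ℤ (LinearMap.ker f) := Module.finBasisOfFinrankEq ℤ _ hrank
  refine ⟨b, (Module.Basis.mkFinCons e b hli hsp).reindex (finRotate (n + 1)).symm, fun i => ?_, ?_⟩
  · simp [Module.Basis.coe_mkFinCons]
  · simp [Module.Basis.coe_mkFinCons]

/-- If a coordinate vanishes on the group of a simplex, then the barycentric coordinate in question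
is integral on the lattice, so that the simplex is a pyramid over the opposite facet. -/
theorem isLatticePyramid_hull {n : ℕ} {v : Fin (n + 1 + 1) → Fin (n + 1) → ℤ}
    (hv : AreSimplexVertices v) (k : Fin (n + 1 + 1)) (hk : ∀ l ∈ vertexGroup v, l k = 0) :
    IsLatticePyramid (hull v) := by
  have hint : ∀ x : Fin (n + 1) → ℤ, ∃ m : ℤ, coordForm hv k (toReal x) = m := fun x =>
    coe_circle_eq_zero_iff.1 (hk (latticeHom hv x) (by rw [← range_latticeHom hv]; exact ⟨x, rfl⟩))
  choose g hg using hint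
  let f : (Fin (n + 1) → ℤ) →ₗ[ℤ] ℤ := AddMonoidHom.toIntLinearMap
    (AddMonoidHom.mk' g fun x y => by
      have : (g (x + y) : ℝ) = g x + g y := by rw [← hg, ← hg, ← hg, toReal_add, map_add]
      exact_mod_cast this)
  have hf : ∀ x, (f x : ℝ) = coordForm hv k (toReal x) := fun x => (hg x).symm
  have hfv : ∀ i j, f (v i - v j) = (if k = i then 1 else 0) - if k = j then 1 else 0 := by
    intro i j
    have := hf (v i - v j)
    rw [coordForm_vertex_sub] at this
    exact_mod_cast this
  set w := v (k.succAbove 0) with hw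
  have hke : f (v k - w) = 1 := by
    rw [hw, hfv, if_pos rfl, if_neg (Fin.ne_succAbove k 0), sub_zero]
  obtain ⟨b, B, hBb, hBe⟩ := exists_basis_snoc f hke
  have hmem : ∀ i, v (k.succAbove i) - w ∈ LinearMap.ker f := by
    intro i
    rw [LinearMap.mem_ker, hw, hfv, if_neg (Fin.ne_succAbove k _), if_neg (Fin.ne_succAbove k _),
      sub_zero]
  let q : Fin (n + 1) → Fin n → ℤ := fun i j => b.repr ⟨_, hmem i⟩ j
  have hq : ∀ i, ∑ j, q i j • (b j : Fin (n + 1) → ℤ) = v (k.succAbove i) - w := by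
    intro i
    have := congrArg Subtype.val (b.sum_repr ⟨_, hmem i⟩)
    rwa [AddSubmonoidClass.coe_finsetSum] at this
  let F := vecMulAdd (Matrix.of fun i => B i) w
  have hFq : ∀ i, F (Fin.snoc (toReal (q i)) (0 : ℝ)) = toReal (v (k.succAbove i)) := by
    intro i
    ext c
    have h := congrFun (congrArg toReal (hq i)) c
    simp only [toReal_apply, Pi.sub_apply, Finset.sum_apply, Pi.smul_apply, smul_eq_mul] at h
    push_cast at h
    rw [vecMulAdd_apply]
    simp [Matrix.vecMul, dotProduct, Fin.sum_univ_castSucc, hBb, h]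
  have hFe : F (Pi.single (Fin.last n) 1) = toReal (v k) := by
    rw [vecMulAdd_apply]
    ext c
    simp [hBe]
  let G : (Fin n → ℝ) →ᵃ[ℝ] (Fin (n + 1) → ℝ) := F.comp (snocZero n).toAffineMap
  have hG : (fun i => G (toReal (q i))) = fun i => toReal (v (k.succAbove i)) := funext hFq
  refine ⟨hull q, ⟨q, ?_, rfl⟩, Matrix.of fun i => B i, w, det_of_basis B, ?_⟩
  · refine AffineIndependent.of_comp G ?_
    change AffineIndependent ℝ fun i => G (toReal (q i))
    rw [hG]
    exact AffineIndependent.comp_embedding (k.succAboveEmb) hv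
  · have hFfun : (fun x : Fin (n + 1) → ℝ =>
        x ᵥ* (Matrix.of fun i => B i).map (fun z : ℤ => (z : ℝ)) + toReal w) = F :=
      funext fun x => (vecMulAdd_apply _ w x).symm
    have hGim : F '' ((fun x : Fin n → ℝ => (Fin.snoc x (0 : ℝ) : Fin (n + 1) → ℝ)) '' hull q) =
        G '' hull q := Set.image_image _ _ _
    rw [hFfun, pyramid, AffineMap.image_convexHull, Set.image_union, hGim, Set.image_singleton,
      hFe, hull, hull, AffineMap.image_convexHull, ← Set.range_comp,
      convexHull_convexHull_union_left]
    change _ = convexHull ℝ (Set.range (fun i => G (toReal (q i))) ∪ _)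
    rw [hG]
    congr 1
    ext x
    simp only [Set.mem_range, Set.mem_union, Set.mem_singleton_iff, Fin.exists_iff_succAbove k]
    tauto

/-! ### Reordering the vertices -/

section Reorder

variable {d : ℕ} {v : Fin (d + 1) → Fin d → ℤ}

lemma AreSimplexVertices.comp_perm (hv : AreSimplexVertices v) (σ : Equiv.Perm (Fin (d + 1))) :
    AreSimplexVertices fun i => v (σ i) :=
  AffineIndependent.comp_embedding σ.toEmbedding hv

lemma hull_comp_perm (v : Fin (d + 1) → Fin d → ℤ) (σ : Equiv.Perm (Fin (d + 1))) :
    hull (fun i => v (σ i)) = hull v := by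
  rw [hull, hull]
  congr 1
  exact σ.surjective.range_comp fun i => toReal (v i)

lemma mem_vertexGroup_comp_perm {l : Fin (d + 1) → UnitAddCircle} (hl : l ∈ vertexGroup v)
    (σ : Equiv.Perm (Fin (d + 1))) : (fun i => l (σ i)) ∈ vertexGroup fun i => v (σ i) :=
  ⟨fun j => (Equiv.sum_comp σ fun i => v i j • l i).trans (hl.1 j),
    (Equiv.sum_comp σ l).trans hl.2⟩

/-- Points with `P` can be moved to the front of `Fin n`, followed by one chosen further point. -/
lemma exists_perm_of_forall_not {n : ℕ} (P : Fin n → Prop) [DecidablePred P] (k : Fin n)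
    (hk : ¬ P k) : ∃ σ : Equiv.Perm (Fin n), ∃ s : Fin n, σ s = k ∧ ∀ i, P (σ i) ↔ i < s := by
  let f : Fin n → ℕ := fun i => if P i then 0 else if i = k then 1 else 2
  have hmono : Monotone (f ∘ Tuple.sort f) := Tuple.monotone_sort f
  set σ := Tuple.sort f
  have hf1 : ∀ i, f (σ i) = 1 ↔ σ i = k := by
    intro i
    by_cases h1 : P (σ i)
    · simp only [f, if_pos h1]
      exact ⟨fun h => absurd h (by norm_num), fun h => absurd (h ▸ h1) hk⟩
    · by_cases h2 : σ i = k <;> simp [f, h1, h2, hk]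
  have hf0 : ∀ i, f (σ i) = 0 ↔ P (σ i) := by
    intro i
    by_cases h1 : P (σ i)
    · simp [f, h1]
    · by_cases h2 : σ i = k <;> simp [f, h1, h2, hk]
  refine ⟨σ, σ.symm k, σ.apply_symm_apply k, fun i => ?_⟩
  have hs : f (σ (σ.symm k)) = 1 := (hf1 _).2 (σ.apply_symm_apply k)
  rw [← hf0]
  constructor
  · intro hi
    by_contra hlt
    have := hmono (not_lt.1 hlt)
    simp only [Function.comp_apply] at this
    omega
  · intro hi
    have h1 := hmono hi.le
    simp only [Function.comp_apply] at h1
    have h2 : f (σ i) ≠ 1 := fun h => hi.ne ((Equiv.eq_symm_apply σ).2 ((hf1 i).1 h))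
    omega

end Reorder

/-! ### Elements of prime order in the torus -/

section Torsion

variable {p : ℕ} [NeZero p]

lemma exists_toAddCircle_eq {c : UnitAddCircle} (hc : p • c = 0) :
    ∃ y : ZMod p, ZMod.toAddCircle y = c := by
  obtain ⟨x, rfl⟩ := QuotientAddGroup.mk_surjective c
  obtain ⟨n, hn⟩ := coe_circle_eq_zero_iff.1
    (show ((p • x : ℝ) : UnitAddCircle) = 0 by rw [AddCircle.coe_nsmul]; exact hc)
  refine ⟨n, ?_⟩
  have hp : (p : ℝ) ≠ 0 := NeZero.ne _
  rw [ZMod.toAddCircle_intCast, ← hn, nsmul_eq_mul, mul_div_cancel_left₀ _ hp]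

lemma nsmul_toAddCircle (y : ZMod p) : p • ZMod.toAddCircle y = 0 := by
  rw [← map_nsmul, nsmul_eq_mul, ZMod.natCast_self, zero_mul, map_zero]

lemma toAddCircle_mul (c y : ZMod p) :
    ZMod.toAddCircle (c * y) = c.val • ZMod.toAddCircle y := by
  rw [← map_nsmul, nsmul_eq_mul, ZMod.natCast_zmod_val]

lemma toAddCircle_one : ZMod.toAddCircle (1 : ZMod p) = ((1 / (p : ℝ) : ℝ) : UnitAddCircle) := by
  have h := ZMod.toAddCircle_intCast (N := p) 1
  rwa [Int.cast_one, Int.cast_one] at h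

/-- The vector over `ℤ/p` of the second generator in the description of the noncyclic case. The
first generator belongs to the difference of the all-ones vector and this one. -/
def pairVector (p s : ℕ) (a : ℕ → ℤ) (i : ℕ) : ZMod p :=
  if i = 0 then ((∑ j ∈ Finset.Icc 1 (s - 1), a j - 1 : ℤ) : ZMod p)
  else if i < s then ((-a i : ℤ) : ZMod p)
  else if i = s then 1
  else 0

lemma torusClass_second_generator (d s : ℕ) (a : ℕ → ℤ) :
    torusClass (fun i : Fin (d + 1) =>
      if (i : ℕ) = 0 then ((∑ j ∈ Finset.Icc 1 (s - 1), (a j : ℝ)) - 1) / (p : ℝ)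
      else if (i : ℕ) < s then ((p : ℝ) - (a i : ℝ)) / (p : ℝ)
      else if (i : ℕ) = s then 1 / (p : ℝ)
      else 0) = fun i : Fin (d + 1) => ZMod.toAddCircle (pairVector p s a i) := by
  have hp : (p : ℝ) ≠ 0 := NeZero.ne _
  funext i
  simp only [torusClass, pairVector]
  split_ifs
  · rw [ZMod.toAddCircle_intCast]; push_cast; rfl
  · rw [show ((-a i : ℤ) : ZMod p) = ((p - a i : ℤ) : ZMod p) by push_cast; simp,
      ZMod.toAddCircle_intCast]
    push_cast; rfl
  · rw [toAddCircle_one]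
  · rw [map_zero]; rfl

lemma torusClass_first_generator (d s : ℕ) (a : ℕ → ℤ) :
    torusClass (fun i : Fin (d + 1) =>
      if (i : ℕ) = 0 then (2 - ∑ j ∈ Finset.Icc 1 (s - 1), (a j : ℝ)) / (p : ℝ)
      else if (i : ℕ) < s then ((a i : ℝ) + 1) / (p : ℝ)
      else if (i : ℕ) = s then 0
      else 1 / (p : ℝ)) = fun i : Fin (d + 1) => ZMod.toAddCircle (1 - pairVector p s a i) := by
  funext i
  simp only [torusClass, pairVector]
  split_ifs
  · rw [show (1 : ZMod p) - ((∑ j ∈ Finset.Icc 1 (s - 1), a j - 1 : ℤ) : ZMod p) =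
      ((2 - ∑ j ∈ Finset.Icc 1 (s - 1), a j : ℤ) : ZMod p) by push_cast; ring,
      ZMod.toAddCircle_intCast]
    push_cast; rfl
  · rw [show (1 : ZMod p) - ((-a i : ℤ) : ZMod p) = ((a i + 1 : ℤ) : ZMod p) by push_cast; ring,
      ZMod.toAddCircle_intCast]
    push_cast; rfl
  · rw [sub_self, map_zero]; rfl
  · rw [sub_zero, toAddCircle_one]

/-- A vector over `ℤ/p` with sum zero which is nonzero in front of position `s`, one there and zero
behind has the form `pairVector`: its first entry is determined by the sum. -/
lemma exists_eq_pairVector {d : ℕ} {y : Fin (d + 1) → ZMod p} (hsum : ∑ i, y i = 0)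
    {s : Fin (d + 1)} (hs : y s = 1) (hs1 : 1 ≤ (s : ℕ)) (hlt : ∀ i, i < s → y i ≠ 0)
    (hgt : ∀ i, s < i → y i = 0) :
    ∃ a : ℕ → ℤ, (∀ i ∈ Finset.Icc 1 ((s : ℕ) - 1), 1 ≤ a i ∧ a i ≤ (p : ℤ) - 1) ∧
      ∀ i, y i = pairVector p s a i := by
  let Y : ℕ → ZMod p := fun i => if h : i < d + 1 then y ⟨i, h⟩ else 0
  have hY : ∀ i : Fin (d + 1), Y i = y i := fun i => dif_pos i.2
  have hcast : ∀ i, (((-Y i).val : ℤ) : ZMod p) = -Y i := fun i => by simp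
  have hsplit : Y 0 + ∑ i ∈ Finset.Icc 1 ((s : ℕ) - 1), Y i + 1 = 0 := by
    have h1 : ∑ i ∈ Finset.range (d + 1), Y i = 0 := by
      rw [Finset.sum_range, ← hsum]
      exact Finset.sum_congr rfl fun i _ => hY i
    have h2 : ∑ i ∈ Finset.range (s + 1), Y i = ∑ i ∈ Finset.range (d + 1), Y i := by
      refine Finset.sum_subset (Finset.range_subset_range.2 s.2) fun i hi hi' => ?_
      rw [Finset.mem_range] at hi hi'
      exact (hY ⟨i, hi⟩).trans (hgt _ (Fin.lt_def.2 (by simpa using hi')))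
    rw [h1, Finset.sum_range_succ, hY, hs, Finset.range_eq_Ico,
      Finset.sum_eq_sum_Ico_succ_bot (by omega)] at h2
    have h3 : Finset.Icc 1 ((s : ℕ) - 1) = Finset.Ico (0 + 1) (s : ℕ) := by ext i; simp; omega
    rw [h3]
    exact h2
  refine ⟨fun i => ((-Y i).val : ℤ), fun i hi => ?_, fun i => ?_⟩
  · rw [Finset.mem_Icc] at hi
    have hid : i < d + 1 := by have := s.2; omega
    have h0 : Y i ≠ 0 := by
      rw [show Y i = y ⟨i, hid⟩ from hY ⟨i, hid⟩]
      exact hlt _ (Fin.lt_def.2 (by simp; omega))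
    have h1 : (-Y i).val ≠ 0 := by
      rw [Ne, ZMod.val_eq_zero, neg_eq_zero]; exact h0
    have h2 := ZMod.val_lt (-Y i)
    beta_reduce
    omega
  · rw [pairVector]
    split_ifs with h1 h2 h3
    · push_cast
      simp only [ZMod.natCast_zmod_val, Finset.sum_neg_distrib]
      rw [← hY i, h1]
      linear_combination hsplit
    · rw [Int.cast_neg, hcast, neg_neg, hY]
    · rw [← hs]; congr 1; exact Fin.ext h3
    · exact hgt i (Fin.lt_def.2 (by omega))

end Torsion

/-! ### Simplices whose normalized volume is the square of a prime -/

section PrimeSquare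

variable {p d : ℕ} {v : Fin (d + 1) → Fin d → ℤ}

/-- An element of the group with a coordinate of full order generates it. -/
lemma vertexGroup_eq_closure_singleton {N : ℕ} (hN : 0 < N)
    (hcard : Nat.card (vertexGroup v) = N) {g : Fin (d + 1) → UnitAddCircle}
    (hg : g ∈ vertexGroup v) {k : Fin (d + 1)} (hk : g k = ((1 / (N : ℝ) : ℝ) : UnitAddCircle)) :
    vertexGroup v = AddSubgroup.closure {g} := by
  have hfin : Finite (vertexGroup v) := Nat.finite_of_card_ne_zero (by omega)
  have hle : AddSubgroup.zmultiples g ≤ vertexGroup v := by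
    rwa [AddSubgroup.zmultiples_le]
  rw [← AddSubgroup.zmultiples_eq_closure]
  refine (AddSubgroup.eq_of_le_of_card_ge hle ?_).symm
  have h1 : N ∣ addOrderOf g := by
    have h := addOrderOf_map_dvd (Pi.evalAddMonoidHom (fun _ : Fin (d + 1) => UnitAddCircle) k) g
    rw [Pi.evalAddMonoidHom_apply, hk, AddCircle.addOrderOf_period_div hN] at h
    exact h
  have h2 := AddSubgroup.card_dvd_of_le hle
  rw [Nat.card_zmultiples, hcard] at h2
  rw [hcard, Nat.card_zmultiples]
  exact Nat.le_of_dvd (Nat.pos_of_dvd_of_pos h2 hN) h1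

/-- Two elements of a group of order `p ^ 2` generate it if their sum is a constant vector of order
`p` and one of them is not constant. -/
lemma vertexGroup_eq_closure_pair [Fact p.Prime] (hcard : Nat.card (vertexGroup v) = p ^ 2)
    {y : Fin (d + 1) → ZMod p} (hone : (fun _ => ZMod.toAddCircle (1 : ZMod p)) ∈ vertexGroup v)
    (hy : (fun i => ZMod.toAddCircle (y i)) ∈ vertexGroup v) {i j : Fin (d + 1)}
    (hij : y i ≠ y j) :
    vertexGroup v = AddSubgroup.closure
      {fun i => ZMod.toAddCircle (1 - y i), fun i => ZMod.toAddCircle (y i)} := by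
  have hp : p.Prime := Fact.out
  have hfin : Finite (vertexGroup v) :=
    Nat.finite_of_card_ne_zero (by rw [hcard]; exact pow_ne_zero 2 hp.ne_zero)
  set e : Fin (d + 1) → UnitAddCircle := fun _ => ZMod.toAddCircle (1 : ZMod p) with he
  set g : Fin (d + 1) → UnitAddCircle := fun i => ZMod.toAddCircle (y i) with hg
  have hsub : (fun i => ZMod.toAddCircle (1 - y i)) = e - g := by
    funext i; simp [he, hg, map_sub]
  rw [hsub]
  set K := AddSubgroup.closure {e - g, g} with hK
  have hgK : g ∈ K := AddSubgroup.subset_closure (by simp)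
  have heK : e ∈ K := by
    have := K.add_mem (AddSubgroup.subset_closure (by simp) : e - g ∈ K) hgK
    rwa [sub_add_cancel] at this
  have hKle : K ≤ vertexGroup v := by
    rw [hK, AddSubgroup.closure_le]
    rintro x (rfl | rfl)
    · exact (vertexGroup v).sub_mem hone hy
    · exact hy
  have hfinK : Finite K := Finite.of_injective _ (AddSubgroup.inclusion_injective hKle)
  have hcardK := AddSubgroup.card_dvd_of_le hKle
  rw [hcard, Nat.dvd_prime_pow hp] at hcardK
  obtain ⟨n, hn, hKn⟩ := hcardK
  refine (AddSubgroup.eq_of_le_of_card_ge hKle ?_).symm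
  rw [hcard, hKn]
  refine Nat.pow_le_pow_right hp.pos ?_
  by_contra hn2
  have hle : AddSubgroup.zmultiples e ≤ K := by rwa [AddSubgroup.zmultiples_le]
  have hord : p ∣ addOrderOf e := by
    have h := addOrderOf_map_dvd (Pi.evalAddMonoidHom (fun _ : Fin (d + 1) => UnitAddCircle) 0) e
    have h1 : e 0 = ((1 / (p : ℝ) : ℝ) : UnitAddCircle) := toAddCircle_one
    rw [Pi.evalAddMonoidHom_apply, h1, AddCircle.addOrderOf_period_div hp.pos] at h
    exact h
  have heq : AddSubgroup.zmultiples e = K := by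
    refine AddSubgroup.eq_of_le_of_card_ge hle ?_
    rw [hKn, Nat.card_zmultiples]
    calc p ^ n ≤ p ^ 1 := Nat.pow_le_pow_right hp.pos (by omega)
      _ = p := pow_one p
      _ ≤ addOrderOf e := Nat.le_of_dvd
        (by
          have := AddSubgroup.card_dvd_of_le hle
          rw [Nat.card_zmultiples] at this
          exact Nat.pos_of_dvd_of_pos this Nat.card_pos) hord
  rw [← heq, AddSubgroup.mem_zmultiples_iff] at hgK
  obtain ⟨m, hm⟩ := hgK
  have hconst : g i = g j := by rw [← hm]; rfl
  exact hij (ZMod.toAddCircle_injective p hconst)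

end PrimeSquare

/-! ### The classification -/

section Classification

variable {p d r : ℕ} {v : Fin (d + 1) → Fin d → ℤ}

lemma sum_ite_lt (d : ℕ) {s : ℕ} (hs : s ≤ d + 1) (a b : ℝ) :
    ∑ i : Fin (d + 1), (if (i : ℕ) < s then a else b) = s * a + (d + 1 - s) * b := by
  rw [Fin.sum_univ_eq_sum_range (fun i => if i < s then a else b) (d + 1),
    ← Nat.add_sub_cancel' hs, Finset.sum_range_add]
  rw [Finset.sum_congr rfl fun i hi => if_pos (Finset.mem_range.1 hi)]
  simp [Nat.cast_sub hs]

/-- If one element with coordinates `1/p` and `1/p^2` generates the group, then these coordinates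
are the reciprocals of the exponents of the coordinate projections, and their sum is `r`. -/
lemma isGorensteinOfIndex_of_cyclic (hp : p.Prime) (hv : AreSimplexVertices v) {s : ℕ}
    (hs : s + 1 ≤ d) (hr : (r : ℤ) * (p : ℤ) ^ 2 - 1 = ((d : ℤ) - (s : ℤ)) + (p : ℤ) * (s : ℤ))
    (hgen : vertexGroup v = AddSubgroup.closure {torusClass fun i : Fin (d + 1) =>
      if (i : ℕ) < s then 1 / (p : ℝ) else 1 / (p : ℝ) ^ 2}) :
    IsGorensteinOfIndex r (hull v) := by
  have hp0 : (p : ℝ) ≠ 0 := Nat.cast_ne_zero.2 hp.ne_zero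
  have hinv : (fun k : Fin (d + 1) => (((if (k : ℕ) < s then p else p ^ 2 : ℕ) : ℝ))⁻¹) =
      fun k : Fin (d + 1) => if (k : ℕ) < s then 1 / (p : ℝ) else 1 / (p : ℝ) ^ 2 := by
    funext k
    split_ifs <;> simp
  refine (isGorensteinOfIndex_hull_iff hv (by omega) r).2 ⟨?_,
    fun k => if (k : ℕ) < s then p else p ^ 2, fun k => ?_, ?_, ?_, fun l hl k => ?_⟩
  · rw [Nat.pos_iff_ne_zero]
    rintro rfl
    have : 0 ≤ (p : ℤ) * s := by positivity
    push_cast at hr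
    omega
  · have := hp.pos
    beta_reduce
    split_ifs <;> positivity
  · rw [hinv, sum_ite_lt d (by omega)]
    have hr' : (r : ℝ) * (p : ℝ) ^ 2 - 1 = ((d : ℝ) - s) + p * s := by exact_mod_cast hr
    field_simp
    linarith
  · rw [hinv, hgen]
    exact AddSubgroup.subset_closure (Set.mem_singleton _)
  · rw [hgen, AddSubgroup.mem_closure_singleton] at hl
    obtain ⟨n, rfl⟩ := hl
    rw [Pi.smul_apply, smul_comm]
    convert smul_zero n
    rw [torusClass, ← AddCircle.coe_nsmul, coe_circle_eq_zero_iff]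
    refine ⟨1, ?_⟩
    beta_reduce
    split_ifs <;> simp [hp0]

/-- The two generators add up to the vector with all coordinates `1/p`. -/
lemma isGorensteinOfIndex_of_noncyclic [Fact p.Prime] (hv : AreSimplexVertices v) (hd : d ≠ 0)
    (hr : (d : ℤ) = (r : ℤ) * (p : ℤ) - 1) {y : Fin (d + 1) → ZMod p}
    (hgen : vertexGroup v = AddSubgroup.closure
      {fun i => ZMod.toAddCircle (1 - y i), fun i => ZMod.toAddCircle (y i)}) :
    IsGorensteinOfIndex r (hull v) := by
  have hp : p.Prime := Fact.out
  have hp0 : (p : ℝ) ≠ 0 := Nat.cast_ne_zero.2 hp.ne_zero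
  refine (isGorensteinOfIndex_hull_iff hv hd r).2 ⟨?_, fun _ => p, fun _ => hp.pos, ?_, ?_,
    fun l hl k => ?_⟩
  · rw [Nat.pos_iff_ne_zero]
    rintro rfl
    push_cast at hr
    omega
  · have hr' : (d : ℝ) = r * p - 1 := by exact_mod_cast hr
    rw [Finset.sum_const, Finset.card_univ, Fintype.card_fin, nsmul_eq_mul]
    push_cast
    rw [hr']
    field_simp
    ring
  · have hone : torusClass (fun _ : Fin (d + 1) => (p : ℝ)⁻¹) =
        (fun i => ZMod.toAddCircle (1 - y i)) + fun i => ZMod.toAddCircle (y i) := by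
      funext i
      rw [Pi.add_apply, ← map_add, sub_add_cancel, toAddCircle_one, one_div]
      rfl
    rw [hgen, hone]
    exact AddSubgroup.add_mem _ (AddSubgroup.subset_closure (by simp))
      (AddSubgroup.subset_closure (by simp))
  · rw [hgen, AddSubgroup.mem_closure_pair] at hl
    obtain ⟨m, n, rfl⟩ := hl
    rw [Pi.add_apply, Pi.smul_apply, Pi.smul_apply, smul_add, smul_comm, nsmul_toAddCircle,
      smul_comm p n, nsmul_toAddCircle, smul_zero, smul_zero, add_zero]

/-- The cyclic case: the element with coordinates `1 / m k` has order `p ^ 2` as soon as one `m k`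
equals `p ^ 2`. -/
lemma exists_cyclic_generator (hp : p.Prime) (hv : AreSimplexVertices v)
    (hvol : normalizedVolume (hull v) = (p : ℝ) ^ 2) {m : Fin (d + 1) → ℕ}
    (hm : ∀ k, m k = p ∨ m k = p ^ 2) (hsum : ∑ k, (m k : ℝ)⁻¹ = r)
    (hmem : torusClass (fun k => (m k : ℝ)⁻¹) ∈ vertexGroup v) {k : Fin (d + 1)}
    (hk : m k = p ^ 2) :
    ∃ s : ℕ, s + 1 ≤ d ∧
      (r : ℤ) * (p : ℤ) ^ 2 - 1 = ((d : ℤ) - (s : ℤ)) + (p : ℤ) * (s : ℤ) ∧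
      ∃ σ : Equiv.Perm (Fin (d + 1)),
        vertexGroup (fun i => v (σ i)) = AddSubgroup.closure
          {torusClass fun i : Fin (d + 1) =>
            if (i : ℕ) < s then 1 / (p : ℝ) else 1 / (p : ℝ) ^ 2} := by
  have hp0 : (p : ℝ) ≠ 0 := Nat.cast_ne_zero.2 hp.ne_zero
  have hne : p ^ 2 ≠ p := by have := hp.two_le; nlinarith
  obtain ⟨σ, s, hσs, hσ⟩ := exists_perm_of_forall_not (fun i => m i = p) k (by rw [hk]; exact hne)
  have hminv : (fun i => ((m (σ i) : ℕ) : ℝ)⁻¹) =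
      fun i : Fin (d + 1) => if (i : ℕ) < (s : ℕ) then 1 / (p : ℝ) else 1 / (p : ℝ) ^ 2 := by
    funext i
    split_ifs with h
    · rw [(hσ i).2 h, one_div]
    · rw [(hm (σ i)).resolve_left fun h' => h ((hσ i).1 h')]
      simp
  have hcount : (r : ℤ) * (p : ℤ) ^ 2 - 1 = ((d : ℤ) - (s : ℤ)) + (p : ℤ) * (s : ℤ) := by
    rw [← Equiv.sum_comp σ, hminv, sum_ite_lt d s.2.le] at hsum
    have : (r : ℝ) * (p : ℝ) ^ 2 - 1 = ((d : ℝ) - (s : ℕ)) + p * (s : ℕ) := by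
      rw [← hsum]
      field_simp
      ring
    exact_mod_cast this
  refine ⟨s, ?_, hcount, σ, ?_⟩
  · have hsd := s.2
    by_contra hlt
    -- if only one coordinate had order `p ^ 2`, then `p` would divide `1`
    have hsd' : ((s : ℕ) : ℤ) = d := by omega
    rw [hsd'] at hcount
    have : (p : ℤ) ∣ 1 := ⟨r * p - d, by linear_combination -hcount⟩
    exact hp.one_lt.ne' (by exact_mod_cast Int.eq_one_of_dvd_one (by positivity) this)
  · have hg := mem_vertexGroup_comp_perm hmem σ
    change torusClass (fun i => ((m (σ i) : ℕ) : ℝ)⁻¹) ∈ _ at hg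
    rw [hminv] at hg
    refine vertexGroup_eq_closure_singleton (N := p ^ 2) (pow_pos hp.pos 2) ?_ hg (k := s) ?_
    · have h := card_vertexGroup_eq_normalizedVolume (hv.comp_perm σ)
      rw [hull_comp_perm, hvol] at h
      exact_mod_cast h
    · simp [torusClass]

/-- The noncyclic case: the group is a plane over `ℤ/p` that contains the all-ones vector. It has a
further vector with a zero coordinate, which can be scaled to have a coordinate `1`. As its
coordinates add up to zero, it has at least two nonzero ones. -/
lemma exists_noncyclic_generators [Fact p.Prime] (hv : AreSimplexVertices v)
    (hvol : normalizedVolume (hull v) = (p : ℝ) ^ 2)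
    (hone : (fun _ => ZMod.toAddCircle (1 : ZMod p)) ∈ vertexGroup v)
    (hkill : ∀ l ∈ vertexGroup v, ∀ k, p • l k = 0) :
    ∃ s : ℕ, 1 ≤ s ∧ s + 1 ≤ d ∧
      ∃ a : ℕ → ℤ, (∀ i ∈ Finset.Icc 1 (s - 1), 1 ≤ a i ∧ a i ≤ (p : ℤ) - 1) ∧
      ∃ σ : Equiv.Perm (Fin (d + 1)),
        vertexGroup (fun i => v (σ i)) = AddSubgroup.closure
          {fun i : Fin (d + 1) => ZMod.toAddCircle (1 - pairVector p s a i),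
            fun i : Fin (d + 1) => ZMod.toAddCircle (pairVector p s a i)} := by
  have hp : p.Prime := Fact.out
  have hcard : ∀ σ : Equiv.Perm (Fin (d + 1)),
      Nat.card (vertexGroup fun i => v (σ i)) = p ^ 2 := by
    intro σ
    have h := card_vertexGroup_eq_normalizedVolume (hv.comp_perm σ)
    rw [hull_comp_perm, hvol] at h
    exact_mod_cast h
  have hcard1 : Nat.card (vertexGroup v) = p ^ 2 := hcard 1
  -- a vector of the plane that is not a multiple of the all-ones vector, made to vanish at `0`
  obtain ⟨x, hx, hx0, k, hxk⟩ : ∃ x : Fin (d + 1) → ZMod p,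
      (fun i => ZMod.toAddCircle (x i)) ∈ vertexGroup v ∧ x 0 = 0 ∧ ∃ k, x k ≠ 0 := by
    by_contra! hall
    have hle : vertexGroup v ≤
        AddSubgroup.zmultiples fun _ : Fin (d + 1) => ZMod.toAddCircle (1 : ZMod p) := by
      intro l hl
      choose x hx using fun i => exists_toAddCircle_eq (hkill l hl i)
      have hmul : (fun i => ZMod.toAddCircle (x i - x 0)) =
          l - (x 0).val • fun _ : Fin (d + 1) => ZMod.toAddCircle (1 : ZMod p) := by
        funext i
        rw [Pi.sub_apply, Pi.smul_apply, ← toAddCircle_mul, mul_one, map_sub, hx]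
      have h := hall (fun i => x i - x 0)
        (by
          rw [hmul]
          exact (vertexGroup v).sub_mem hl ((vertexGroup v).nsmul_mem hone _)) (sub_self _)
      have hl' : l = (x 0).val • fun _ : Fin (d + 1) => ZMod.toAddCircle (1 : ZMod p) := by
        rw [← sub_eq_zero, ← hmul]
        funext i
        rw [h i, map_zero, Pi.zero_apply]
      rw [hl']
      exact AddSubgroup.nsmul_mem _ (AddSubgroup.mem_zmultiples _) _
    have h1 := AddSubgroup.card_dvd_of_le hle
    have h2 : addOrderOf (fun _ : Fin (d + 1) => ZMod.toAddCircle (1 : ZMod p)) ∣ p :=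
      addOrderOf_dvd_of_nsmul_eq_zero (funext fun i => nsmul_toAddCircle 1)
    rw [Nat.card_zmultiples, hcard1] at h1
    have h3 := Nat.le_of_dvd hp.pos (h1.trans h2)
    have := hp.two_le
    nlinarith
  -- scale the coordinate `k` to `1`
  obtain ⟨y, hy, hy0, hyk⟩ : ∃ y : Fin (d + 1) → ZMod p,
      (fun i => ZMod.toAddCircle (y i)) ∈ vertexGroup v ∧ y 0 = 0 ∧ y k = 1 := by
    refine ⟨fun i => (x k)⁻¹ * x i, ?_, by simp [hx0], inv_mul_cancel₀ hxk⟩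
    simp only [toAddCircle_mul]
    exact (vertexGroup v).nsmul_mem hx _
  have hysum : ∑ i, y i = 0 := by
    have h := hy.2
    rw [← map_sum, ← map_zero (ZMod.toAddCircle (N := p))] at h
    exact ZMod.toAddCircle_injective p h
  -- order the coordinates: nonzero ones, then `k`, then zeros
  obtain ⟨σ, s, hσs, hσ⟩ :=
    exists_perm_of_forall_not (fun i => y i ≠ 0 ∧ i ≠ k) k (fun h => h.2 rfl)
  have hlt : ∀ i, i < s → y (σ i) ≠ 0 := fun i hi => ((hσ i).2 hi).1
  have hgt : ∀ i, s < i → y (σ i) = 0 := by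
    intro i hi
    by_contra h
    refine hi.not_gt ((hσ i).1 ⟨h, fun hik => hi.ne ?_⟩)
    rw [← hσs] at hik
    exact (σ.injective hik).symm
  have hs : y (σ s) = 1 := by rw [hσs, hyk]
  have hσsum : ∑ i, y (σ i) = 0 := (Equiv.sum_comp σ y).trans hysum
  have hs1 : 1 ≤ (s : ℕ) := by
    by_contra h
    have h0 : ∀ i, i ≠ s → y (σ i) = 0 := fun i hi =>
      hgt i (lt_of_le_of_ne (Fin.le_def.2 (by omega)) hi.symm)
    rw [Fintype.sum_eq_single s h0, hs] at hσsum
    exact one_ne_zero hσsum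
  have hzero : s < σ.symm 0 := by
    by_contra h
    rcases (not_lt.1 h).lt_or_eq with h | h
    · exact hlt _ h (by rw [σ.apply_symm_apply, hy0])
    · rw [← h, σ.apply_symm_apply, hy0] at hs
      exact zero_ne_one hs
  obtain ⟨a, ha, hya⟩ := exists_eq_pairVector hσsum hs hs1 hlt hgt
  refine ⟨s, hs1, ?_, a, ha, σ, ?_⟩
  · have := (σ.symm 0).2
    have := Fin.lt_def.1 hzero
    omega
  · simp only [← hya]
    refine vertexGroup_eq_closure_pair (y := fun i => y (σ i)) (hcard σ)
      (mem_vertexGroup_comp_perm hone σ)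
      (mem_vertexGroup_comp_perm hy σ) (i := s) (j := σ.symm 0) ?_
    rw [hs, σ.apply_symm_apply, hy0]
    exact one_ne_zero

end Classification

end GorensteinSimplex

open GorensteinSimplex in
theorem theorem0p2 (p d r : ℕ) (hp : p.Prime) (v : Fin (d + 1) → Fin d → ℤ)
    (hv : GorensteinSimplex.AreSimplexVertices v)
    (hvol : GorensteinSimplex.normalizedVolume (GorensteinSimplex.hull v) = (p : ℝ) ^ 2)
    (hpyr : ¬ GorensteinSimplex.IsLatticePyramid (GorensteinSimplex.hull v)) :
    GorensteinSimplex.IsGorensteinOfIndex r (GorensteinSimplex.hull v) ↔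
      (∃ s : ℕ, s + 1 ≤ d ∧
        (r : ℤ) * (p : ℤ) ^ 2 - 1 = ((d : ℤ) - (s : ℤ)) + (p : ℤ) * (s : ℤ) ∧
        ∃ σ : Equiv.Perm (Fin (d + 1)),
          GorensteinSimplex.vertexGroup (fun i => v (σ i)) =
            AddSubgroup.closure
              {GorensteinSimplex.torusClass fun i : Fin (d + 1) =>
                if (i : ℕ) < s then 1 / (p : ℝ) else 1 / (p : ℝ) ^ 2}) ∨
      ((d : ℤ) = (r : ℤ) * (p : ℤ) - 1 ∧
        ∃ s : ℕ, 1 ≤ s ∧ s + 1 ≤ d ∧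
        ∃ a : ℕ → ℤ, (∀ i ∈ Finset.Icc 1 (s - 1), 1 ≤ a i ∧ a i ≤ (p : ℤ) - 1) ∧
        ∃ σ : Equiv.Perm (Fin (d + 1)),
          GorensteinSimplex.vertexGroup (fun i => v (σ i)) =
            AddSubgroup.closure
              {GorensteinSimplex.torusClass (fun i : Fin (d + 1) =>
                if (i : ℕ) = 0 then (2 - ∑ j ∈ Finset.Icc 1 (s - 1), (a j : ℝ)) / (p : ℝ)
                else if (i : ℕ) < s then ((a i : ℝ) + 1) / (p : ℝ)
                else if (i : ℕ) = s then 0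
                else 1 / (p : ℝ)),
               GorensteinSimplex.torusClass (fun i : Fin (d + 1) =>
                if (i : ℕ) = 0 then ((∑ j ∈ Finset.Icc 1 (s - 1), (a j : ℝ)) - 1) / (p : ℝ)
                else if (i : ℕ) < s then ((p : ℝ) - (a i : ℝ)) / (p : ℝ)
                else if (i : ℕ) = s then 1 / (p : ℝ)
                else 0)}) := by
  have : Fact p.Prime := ⟨hp⟩
  simp only [torusClass_first_generator, torusClass_second_generator]
  have hp0 : (p : ℝ) ≠ 0 := Nat.cast_ne_zero.2 hp.ne_zero
  constructor
  · intro hG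
    have hcard := card_vertexGroup_eq_normalizedVolume hv
    rw [hvol] at hcard
    have hcard' : Nat.card (vertexGroup v) = p ^ 2 := by exact_mod_cast hcard
    have hd : d ≠ 0 := by
      rintro rfl
      -- in dimension zero the group is trivial
      have h := card_vertexGroup hv
      rw [hcard', Matrix.det_fin_zero, Int.natAbs_one] at h
      exact hp.ne_one (pow_eq_one_iff_left two_ne_zero |>.1 h)
    obtain ⟨-, m, hm0, hsum, hmem, hkill⟩ := (isGorensteinOfIndex_hull_iff hv hd r).1 hG
    have hm : ∀ k, m k = p ∨ m k = p ^ 2 := by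
      intro k
      have h1 : m k ∣ p ^ 2 := by
        have h := congrFun (congrArg Subtype.val
          (card_nsmul_eq_zero' (x := (⟨_, hmem⟩ : vertexGroup v)))) k
        rw [hcard'] at h
        have hdvd := addOrderOf_dvd_of_nsmul_eq_zero
          (show (p ^ 2) • (((m k : ℝ)⁻¹ : ℝ) : UnitAddCircle) = 0 from h)
        rwa [← one_div, AddCircle.addOrderOf_period_div (hm0 k)] at hdvd
      obtain ⟨n, hn, hmn⟩ := (Nat.dvd_prime_pow hp).1 h1
      interval_cases n
      -- `m k = 1` would make the simplex a pyramid with apex `v k`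
      · exfalso
        obtain ⟨n, rfl⟩ := Nat.exists_eq_succ_of_ne_zero hd
        refine hpyr (isLatticePyramid_hull hv k fun l hl => ?_)
        have := hkill l hl k
        rwa [hmn, pow_zero, one_smul] at this
      · left; rw [hmn, pow_one]
      · right; exact hmn
    by_cases hex : ∃ k, m k = p ^ 2
    · obtain ⟨k, hk⟩ := hex
      exact Or.inl (exists_cyclic_generator hp hv hvol hm hsum hmem hk)
    · have hmp : ∀ k, m k = p := fun k => (hm k).resolve_right fun h => hex ⟨k, h⟩
      refine Or.inr ⟨?_, exists_noncyclic_generators hv hvol ?_ fun l hl k => ?_⟩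
      · simp only [hmp, Finset.sum_const, Finset.card_univ, Fintype.card_fin, nsmul_eq_mul] at hsum
        have h : (d : ℝ) = r * p - 1 := by
          rw [← hsum]
          push_cast
          field_simp
          ring
        exact_mod_cast h
      · convert hmem using 1
        funext k
        rw [toAddCircle_one, torusClass, hmp, one_div]
      · rw [← hmp k]
        exact hkill l hl k
  · rintro (⟨s, hs, hr, σ, hgen⟩ | ⟨hr, s, -, hs, a, -, σ, hgen⟩)
    · rw [← hull_comp_perm v σ]
      exact isGorensteinOfIndex_of_cyclic hp (hv.comp_perm σ) hs hr hgen
    · rw [← hull_comp_perm v σ]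
      exact isGorensteinOfIndex_of_noncyclic (hv.comp_perm σ) (by omega) hr hgen
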